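/- Let $A$ be an Artin algebra and let $\mathrm{mod}\,A$ be the category of finitely generated right $A$-modules. For $M\in\mathrm{mod}\,A$ let $\Omega(M)$ be the kernel of the projective cover of $M$. Let $K_0(A)$ be the abelian group generated by the symbols $[M]$, $M\in\mathrm{mod}\,A$, modulo the relations $[M]=[M']+[M'']$ whenever $M\cong M'\oplus M''$ and $[P]=0$ whenever $P$ is projective, and let $\bar\Omega:K_0(A)\to K_0(A)$ be the endomorphism with $\bar\Omega([M])=[\Omega(M)]$. For $M\in\mathrm{mod}\,A$ let $\langle \mathrm{add}\,M\rangle\subseteq K_0(A)$ be the subgroup generated by the classes of the indecomposable direct summands of $M$. For an endomorphism $L$ of a free abelian group $G$ and a finitely generated subgroup $X\subseteq G$ put $$\eta_L(X)=\min\{l\in\mathbb{N} : L|_{L^{l+s}(X)}\text{ is injective for all } s\ge 0\},$$ which exists by Fitting's lemma. Put $\phi(M)=\eta_{\bar\Omega}(\langle\mathrm{add}\,M\rangle)$ and, for a class $\mathcal D\subseteq\mathrm{mod}\,A$, $\phi\dim(\mathcal D)=\sup\{\phi(M):M\in\mathcal D\}$. Let $\mathrm{add}(\mathcal D)$ be the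 class of all direct summands of finite direct sums of modules in $\mathcal D$. A class $\mathcal D\subseteq\mathrm{mod}\,A$ is a $0$-Igusa-Todorov subcategory if $\mathcal D=\mathrm{add}(\mathcal D)$, $\Omega(\mathcal D)\subseteq\mathcal D$ and $\phi\dim(\mathcal D)=0$. It is a $0$-Igusa-Todorov subcategory with preimages if, moreover, for every $D\in\mathcal D$ there are $D',D''\in\mathcal D$ and an integer $m>0$ with $\bar\Omega([D']-[D''])=m[D]$. If $\mathcal D=\mathrm{add}(\mathcal D)$ and $\Omega(\mathcal D)\subseteq\mathcal D$, let $\langle\mathcal D\rangle\subseteq K_0(A)$ be the subgroup generated by the classes $[D]$, $D\in\mathcal D$ (so that $K_0(A)/\langle\mathcal D\rangle$ is free abelian), let $\bar\Omega_{\mathcal D}$ be the endomorphism of $K_0(A)/\langle\mathcal D\rangle$ induced by $\bar\Omega$, and for $M\in\mathrm{mod}\,A$ put $$\Phi_{[\mathcal D]}(M)=\eta_{\bar\Omega_{\mathcal D}}\big((\langle\mathrm{add}\,M\rangle+\langle\mathcal D\rangle)/\langle\mathcal D\rangle\big).$$ Let $\mathcal D_1\subseteq\mathcal D_2\subseteq\mathrm{mod}\,A$,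 where $\mathcal D_2$ is a $0$-Igusa-Todorov subcategory and $\mathcal D_1$ is a $0$-Igusa-Todorov subcategory with preimages. Then for every $M\in\mathrm{mod}\,A$, $$\Phi_{[\mathcal D_1]}(M)\le\Phi_{[\mathcal D_2]}(M).$$ -/

import Mathlib

universe u v

/-- A ring `A` is an *Artin algebra* if it is a finitely generated (as a module) algebra over some
commutative artinian ring. The base ring is taken in the universe of `A`, which is no restriction:
see `IsArtinAlgebra.of_finite`. -/
class IsArtinAlgebra (A : Type u) [Ring A] : Prop where
  exists_base : ∃ (R : Type u) (_ : CommRing R) (_ : IsArtinianRing R) (_ : Algebra R A),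
    Module.Finite R A

theorem IsArtinAlgebra.of_finite (R : Type v) (A : Type u) [CommRing R] [IsArtinianRing R] [Ring A]
    [Algebra R A] [Module.Finite R A] : IsArtinAlgebra A := by
  have h1 : Module.Finite R (Subalgebra.center R A) :=
    inferInstanceAs (Module.Finite R (Subalgebra.toSubmodule (Subalgebra.center R A)))
  have h2 : IsArtinianRing (Subalgebra.center R A) := IsArtinianRing.of_finite R _
  let alg : Algebra (Subalgebra.center R A) A :=
    { (inferInstance : SMul (Subalgebra.center R A) A) with
      algebraMap := (Subalgebra.center R A).val.toRingHom
      commutes' := fun c x => (Subalgebra.mem_center_iff.1 c.2 x).symm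
      smul_def' := fun _ _ => rfl }
  have : @IsScalarTower R (Subalgebra.center R A) A _ alg.toSMul _ :=
    ⟨fun r c x => smul_mul_assoc r (c : A) x⟩
  exact ⟨⟨Subalgebra.center R A, inferInstance, h2, alg,
    Module.Finite.of_restrictScalars_finite R _ _⟩⟩

instance IsArtinAlgebra.isArtinianRing_op (A : Type u) [Ring A] [h : IsArtinAlgebra A] :
    IsArtinianRing Aᵐᵒᵖ := by
  obtain ⟨R, _, _, _, _⟩ := h.exists_base
  have : Module.Finite R Aᵐᵒᵖ := Module.Finite.equiv (MulOpposite.opLinearEquiv R)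
  exact IsArtinianRing.of_finite R _

namespace IgusaTodorov

noncomputable section

section Ring

variable {B : Type u} [Ring B]

/-! ### Additive closures, indecomposable modules -/

/-- `N` is (isomorphic to) a direct summand of `M`. -/
def IsSummand (N M : FGModuleCat.{u} B) : Prop :=
  ∃ N' : FGModuleCat.{u} B, Nonempty (M ≃ₗ[B] N × N')

/-- `M` is nonzero and is not the internal direct sum of two nonzero submodules. -/
def IsIndecomposable (M : FGModuleCat.{u} B) : Prop :=
  Nontrivial M ∧ ∀ p q : Submodule B M, IsCompl p q → p = ⊥ ∨ q = ⊥

/-- `add D`: the direct summands of finite (possibly empty) direct sums of modules in `D`. -/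
def addClosure (D : CategoryTheory.ObjectProperty (FGModuleCat.{u} B)) :
    CategoryTheory.ObjectProperty (FGModuleCat.{u} B) :=
  fun M => ∃ (n : ℕ) (X : Fin n → FGModuleCat.{u} B), (∀ i, D (X i)) ∧
    IsSummand M (FGModuleCat.of B (∀ i, X i))

/-! ### The group `K₀` -/

variable (B) in
/-- The relations `[M] - [M'] - [M'']` for `M ≅ M' ⊕ M''` and `[P]` for `P` projective. -/
def k0Relations : Set (FreeAbelianGroup (FGModuleCat.{u} B)) :=
  {x | ∃ M M' M'' : FGModuleCat.{u} B, Nonempty (M ≃ₗ[B] M' × M'') ∧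
      x = FreeAbelianGroup.of M - FreeAbelianGroup.of M' - FreeAbelianGroup.of M''} ∪
  {x | ∃ P : FGModuleCat.{u} B, Module.Projective B P ∧ x = FreeAbelianGroup.of P}

variable (B) in
/-- The abelian group generated by the symbols `[M]` of the finitely generated modules, modulo
`[M] = [M'] + [M'']` for `M ≅ M' ⊕ M''` and `[P] = 0` for `P` projective. -/
abbrev K0 : Type (u + 1) :=
  FreeAbelianGroup (FGModuleCat.{u} B) ⧸ AddSubgroup.closure (k0Relations B)

/-- The class `[M]` in `K0 B`. -/
def K0.cls (M : FGModuleCat.{u} B) : K0 B :=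
  QuotientAddGroup.mk (FreeAbelianGroup.of M)

theorem K0.cls_of_equiv_prod {M M' M'' : FGModuleCat.{u} B} (e : M ≃ₗ[B] M' × M'') :
    K0.cls M = K0.cls M' + K0.cls M'' := by
  have h : (QuotientAddGroup.mk (FreeAbelianGroup.of M - FreeAbelianGroup.of M'
      - FreeAbelianGroup.of M'') : K0 B) = 0 :=
    (QuotientAddGroup.eq_zero_iff _).2
      (AddSubgroup.subset_closure (Or.inl ⟨M, M', M'', ⟨e⟩, rfl⟩))
  have h' : K0.cls M - K0.cls M' - K0.cls M'' = 0 := h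
  rw [sub_sub, sub_eq_zero] at h'
  exact h'

theorem K0.cls_projective (P : FGModuleCat.{u} B) (hP : Module.Projective B P) :
    K0.cls P = 0 :=
  (QuotientAddGroup.eq_zero_iff _).2 (AddSubgroup.subset_closure (Or.inr ⟨P, hP, rfl⟩))

/-- `⟨add M⟩`: the subgroup of `K0 B` generated by the classes of the indecomposable direct
summands of `M`. -/
def addSpan (M : FGModuleCat.{u} B) : AddSubgroup (K0 B) :=
  AddSubgroup.closure {x | ∃ N, IsIndecomposable N ∧ IsSummand N M ∧ x = K0.cls N}

/-- `⟨D⟩`: the subgroup of `K0 B` generated by the classes of the modules in `D`. -/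
def classSpan (D : CategoryTheory.ObjectProperty (FGModuleCat.{u} B)) : AddSubgroup (K0 B) :=
  AddSubgroup.closure {x | ∃ N, D N ∧ x = K0.cls N}

/-! ### Projective covers and syzygies -/

/-- `f : P → M` is a projective cover: `P` is projective, `f` is onto and `ker f` is superfluous. -/
structure IsProjectiveCover {P M : Type u} [AddCommGroup P] [Module B P] [AddCommGroup M]
    [Module B M] (f : P →ₗ[B] M) : Prop where
  projective : Module.Projective B P
  surjective : Function.Surjective f
  superfluous : ∀ N : Submodule B P, N ⊔ LinearMap.ker f = ⊤ → N = ⊤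

variable [IsArtinianRing B]

theorem exists_projectiveCover (M : FGModuleCat.{u} B) :
    ∃ (P : FGModuleCat.{u} B) (f : P →ₗ[B] M), IsProjectiveCover f := by
  classical
  have hex : ∃ (l : ℕ∞) (P : FGModuleCat.{u} B) (f : P →ₗ[B] M),
      Module.length B P = l ∧ Module.Projective B P ∧ Function.Surjective f := by
    obtain ⟨n, f, hf⟩ := Module.Finite.exists_fin' B M
    exact ⟨_, FGModuleCat.of B (Fin n → B), f, rfl, inferInstanceAs (Module.Projective B (Fin n → B)),
      hf⟩
  obtain ⟨l, ⟨P, f, hl, hP, hf⟩, hmin⟩ := WellFounded.has_min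
    (wellFounded_lt (α := ℕ∞)) {l | ∃ (P : FGModuleCat.{u} B) (f : P →ₗ[B] M),
      Module.length B P = l ∧ Module.Projective B P ∧ Function.Surjective f} hex
  refine ⟨P, f, hP, hf, fun N hN => ?_⟩
  have hNs : Function.Surjective (f ∘ₗ N.subtype) := by
    intro m
    obtain ⟨p, rfl⟩ := hf m
    have hp : p ∈ N ⊔ LinearMap.ker f := hN ▸ Submodule.mem_top
    obtain ⟨a, ha, b, hb, rfl⟩ := Submodule.mem_sup.1 hp
    exact ⟨⟨a, ha⟩, by simp [LinearMap.mem_ker.1 hb]⟩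
  obtain ⟨g, hg⟩ := Module.projective_lifting_property (f ∘ₗ N.subtype) f hNs
  let t : Module.End B P := N.subtype ∘ₗ g
  have ht : ∀ p, f (t p) = f p := fun p => LinearMap.congr_fun hg p
  have htn : ∀ (n : ℕ) p, f ((t ^ n) p) = f p := by
    intro n
    induction n with
    | zero => intro p; simp
    | succ k ih => intro p; rw [pow_succ, Module.End.mul_apply, ih, ht]
  obtain ⟨n, hn0, hn⟩ := ((Filter.eventually_gt_atTop 0).and
    (LinearMap.eventually_isCompl_ker_pow_range_pow t)).exists
  have hproj : Module.Projective B (LinearMap.range (t ^ n)) :=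
    Module.Projective.of_split (LinearMap.range (t ^ n)).subtype
      (Submodule.projectionOnto _ _ hn.symm)
      (Submodule.projectionOnto_comp_subtype hn.symm)
  have hsurj : Function.Surjective (f ∘ₗ (LinearMap.range (t ^ n)).subtype) := by
    intro m
    obtain ⟨p, rfl⟩ := hf m
    exact ⟨⟨(t ^ n) p, p, rfl⟩, htn n p⟩
  have hlen : ¬ Module.length B (LinearMap.range (t ^ n)) < l :=
    hmin _ ⟨FGModuleCat.of B (LinearMap.range (t ^ n)), f ∘ₗ (LinearMap.range (t ^ n)).subtype, rfl,
      hproj, hsurj⟩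
  have htop : LinearMap.range (t ^ n) = ⊤ := by
    by_contra hne
    exact hlen (hl ▸ Submodule.length_lt hne)
  refine eq_top_iff.2 (htop ▸ ?_)
  rintro _ ⟨p, rfl⟩
  obtain ⟨k, rfl⟩ := Nat.exists_eq_succ_of_ne_zero hn0.ne'
  rw [Nat.succ_eq_add_one, pow_succ', Module.End.mul_apply]
  exact (g _).2

/-- The projective cover `P(M)`. -/
def cover (M : FGModuleCat.{u} B) : FGModuleCat.{u} B := (exists_projectiveCover M).choose

/-- The projection `P(M) → M`. -/
def coverMap (M : FGModuleCat.{u} B) : cover M →ₗ[B] M :=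
  (exists_projectiveCover M).choose_spec.choose

theorem coverMap_isProjectiveCover (M : FGModuleCat.{u} B) : IsProjectiveCover (coverMap M) :=
  (exists_projectiveCover M).choose_spec.choose_spec

/-- The syzygy `Ω(M)`: the kernel of the projective cover of `M`. -/
def syzygy (M : FGModuleCat.{u} B) : FGModuleCat.{u} B :=
  FGModuleCat.of B (LinearMap.ker (coverMap M))

/-- Schanuel's lemma in `K0 B`. -/
theorem K0.cls_ker_eq {P P' M : FGModuleCat.{u} B} (hP : Module.Projective B P)
    (hP' : Module.Projective B P') (f : P →ₗ[B] M) (f' : P' →ₗ[B] M)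
    (hf : Function.Surjective f) (hf' : Function.Surjective f') :
    K0.cls (FGModuleCat.of B (LinearMap.ker f)) = K0.cls (FGModuleCat.of B (LinearMap.ker f')) := by
  obtain ⟨g, hg⟩ := Module.projective_lifting_property f' f hf'
  obtain ⟨h, hh⟩ := Module.projective_lifting_property f f' hf
  have hg' : ∀ p, f' (g p) = f p := fun p => LinearMap.congr_fun hg p
  have hh' : ∀ p, f (h p) = f' p := fun p => LinearMap.congr_fun hh p
  let e : (P × LinearMap.ker f') ≃ₗ[B] (LinearMap.ker f × P') :=
    { toFun := fun x => (⟨x.1 - h (g x.1 + x.2), by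
        have := x.2.2
        rw [LinearMap.mem_ker] at this ⊢
        simp [hg', hh', this]⟩, g x.1 + x.2)
      invFun := fun y => (y.1 + h y.2, ⟨y.2 - g (y.1 + h y.2), by
        have := y.1.2
        rw [LinearMap.mem_ker] at this ⊢
        simp [hg', hh', this]⟩)
      map_add' := fun x y => by
        ext
        · simp only [Prod.fst_add, Prod.snd_add, map_add, Submodule.coe_add]; abel
        · simp only [Prod.fst_add, Prod.snd_add, map_add, Submodule.coe_add]; abel
      map_smul' := fun c x => by
        ext
        · simp [smul_sub, smul_add]
        · simp [smul_add]
      left_inv := fun x => by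
        ext
        · simp
        · simp
      right_inv := fun y => by
        ext
        · simp
        · simp }
  have h1 := K0.cls_of_equiv_prod (M := FGModuleCat.of B (P × LinearMap.ker f')) (M' := P)
    (M'' := FGModuleCat.of B (LinearMap.ker f')) (LinearEquiv.refl B _)
  have h2 := K0.cls_of_equiv_prod (M := FGModuleCat.of B (P × LinearMap.ker f'))
    (M' := FGModuleCat.of B (LinearMap.ker f)) (M'' := P') e
  rw [K0.cls_projective P hP, zero_add] at h1
  rw [K0.cls_projective P' hP', add_zero] at h2
  exact h2.symm.trans h1

theorem K0.cls_syzygy_prod {M M' M'' : FGModuleCat.{u} B} (e : M ≃ₗ[B] M' × M'') :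
    K0.cls (syzygy M) = K0.cls (syzygy M') + K0.cls (syzygy M'') := by
  have c := coverMap_isProjectiveCover M
  have c' := coverMap_isProjectiveCover M'
  have c'' := coverMap_isProjectiveCover M''
  have := c'.projective
  have := c''.projective
  let F : (cover M' × cover M'') →ₗ[B] M :=
    e.symm.toLinearMap ∘ₗ (coverMap M').prodMap (coverMap M'')
  have hF : Function.Surjective F :=
    e.symm.surjective.comp (c'.surjective.prodMap c''.surjective)
  have hk : ∀ x, x ∈ LinearMap.ker F ↔ coverMap M' x.1 = 0 ∧ coverMap M'' x.2 = 0 := by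
    intro x
    simp [F]
  rw [syzygy, K0.cls_ker_eq (P' := FGModuleCat.of B (cover M' × cover M'')) c.projective
    (inferInstanceAs (Module.Projective B (cover M' × cover M''))) (coverMap M) F c.surjective hF]
  refine K0.cls_of_equiv_prod (M' := syzygy M') (M'' := syzygy M'') (show
    LinearMap.ker F ≃ₗ[B] LinearMap.ker (coverMap M') × LinearMap.ker (coverMap M'') from
    { toFun := fun x => (⟨x.1.1, ((hk _).1 x.2).1⟩, ⟨x.1.2, ((hk _).1 x.2).2⟩)
      invFun := fun y => ⟨(y.1, y.2), (hk _).2 ⟨y.1.2, y.2.2⟩⟩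
      map_add' := fun _ _ => rfl
      map_smul' := fun _ _ => rfl
      left_inv := fun _ => rfl
      right_inv := fun _ => rfl })

theorem K0.cls_syzygy_projective (P : FGModuleCat.{u} B) (hP : Module.Projective B P) :
    K0.cls (syzygy P) = 0 := by
  have c := coverMap_isProjectiveCover P
  rw [syzygy, K0.cls_ker_eq c.projective hP (coverMap P) LinearMap.id c.surjective
    Function.surjective_id]
  refine K0.cls_projective _ ?_
  have : Subsingleton (LinearMap.ker (LinearMap.id : P →ₗ[B] P)) := by
    rw [LinearMap.ker_id]; infer_instance
  exact inferInstanceAs (Module.Projective B (LinearMap.ker (LinearMap.id : P →ₗ[B] P)))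

variable (B) in
/-- The endomorphism of `K0 B` induced by the syzygy: `[M] ↦ [Ω(M)]`. -/
def omegaBar : AddMonoid.End (K0 B) :=
  QuotientAddGroup.lift _ (FreeAbelianGroup.lift fun M => K0.cls (syzygy M)) (by
    rw [AddSubgroup.closure_le]
    rintro _ (⟨M, M', M'', ⟨e⟩, rfl⟩ | ⟨P, hP, rfl⟩)
    · simp [K0.cls_syzygy_prod e]
    · simp [K0.cls_syzygy_projective P hP])

theorem omegaBar_cls (M : FGModuleCat.{u} B) : omegaBar B (K0.cls M) = K0.cls (syzygy M) := by
  exact FreeAbelianGroup.lift_apply_of (fun M => K0.cls (syzygy M)) M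

/-! ### Igusa-Todorov functions -/

/-- For an endomorphism `L` of an abelian group and a subgroup `X`, the least `l` such that the
restriction of `L` to `L ^ (l + s) (X)` is injective for all `s ≥ 0`. (By Fitting's lemma such an
`l` exists whenever `X` is finitely generated and the ambient group is free.) -/
def eta {G : Type*} [AddCommGroup G] (L : AddMonoid.End G) (X : AddSubgroup G) : ℕ :=
  sInf {l : ℕ | ∀ s : ℕ, Set.InjOn L ((fun x => (L ^ (l + s)) x) '' (X : Set G))}

/-- The Igusa-Todorov function `φ`. -/
def phi (M : FGModuleCat.{u} B) : ℕ := eta (omegaBar B) (addSpan M)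

/-- `φdim D = sup {φ(M) : M ∈ D}`. -/
def phiDim (D : CategoryTheory.ObjectProperty (FGModuleCat.{u} B)) : ℕ∞ :=
  ⨆ (M : FGModuleCat.{u} B) (_ : D M), (phi M : ℕ∞)

/-- `Ω(D) ⊆ D`. -/
def SyzygyInvariant (D : CategoryTheory.ObjectProperty (FGModuleCat.{u} B)) : Prop :=
  ∀ M, D M → D (syzygy M)

theorem SyzygyInvariant.classSpan_le {D : CategoryTheory.ObjectProperty (FGModuleCat.{u} B)}
    (hD : SyzygyInvariant D) : classSpan D ≤ (classSpan D).comap (omegaBar B) := by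
  rw [classSpan, AddSubgroup.closure_le]
  rintro _ ⟨N, hN, rfl⟩
  exact AddSubgroup.subset_closure ⟨syzygy N, hD N hN, omegaBar_cls N⟩

/-- The endomorphism of `K0 B ⧸ ⟨D⟩` induced by the syzygy. -/
def omegaBarQuot (D : CategoryTheory.ObjectProperty (FGModuleCat.{u} B)) (hD : SyzygyInvariant D) :
    AddMonoid.End (K0 B ⧸ classSpan D) :=
  QuotientAddGroup.map (classSpan D) (classSpan D) (omegaBar B) hD.classSpan_le

/-- The generalized Igusa-Todorov function `Φ_[D]`, evaluated at `M`. -/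
def Phi (D : CategoryTheory.ObjectProperty (FGModuleCat.{u} B)) (hD : SyzygyInvariant D)
    (M : FGModuleCat.{u} B) : ℕ :=
  eta (omegaBarQuot D hD) ((addSpan M).map (QuotientAddGroup.mk' (classSpan D)))

/-- `D` is a `0`-Igusa-Todorov subcategory: `D = add D`, `Ω(D) ⊆ D` and `φdim D = 0`. -/
structure IsZeroIT (D : CategoryTheory.ObjectProperty (FGModuleCat.{u} B)) : Prop where
  eq_addClosure : D = addClosure D
  syzygyInvariant : SyzygyInvariant D
  phiDim_eq_zero : phiDim D = 0

/-- `D` is a `0`-Igusa-Todorov subcategory with preimages. -/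
structure IsZeroITWithPreimages (D : CategoryTheory.ObjectProperty (FGModuleCat.{u} B)) : Prop
    extends IsZeroIT D where
  exists_preimage : ∀ N, D N → ∃ N₁ N₂ : FGModuleCat.{u} B, D N₁ ∧ D N₂ ∧
    ∃ m : ℕ, 0 < m ∧ omegaBar B (K0.cls N₁ - K0.cls N₂) = m • K0.cls N

end Ring

end

end IgusaTodorov

/-!
Write `L` for the syzygy endomorphism of `K0` and `Sᵢ = ⟨Dᵢ⟩`, so that `S₁ ≤ S₂` are
`L`-invariant. Put `l = Φ_[D₂](M)`, let `n ≥ l`, and let `x ∈ ⟨add M⟩` satisfy `L ^ (n + 1) x ∈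
S₁`. It has to be shown that `L ^ n x ∈ S₁`. As `L ^ (n + 1) x ∈ S₂`, the choice of `l` gives `L ^
n x ∈ S₂`. As `D₁` has preimages, there are `t ∈ S₁` and `m > 0` with `L t = m • L ^ (n + 1) x`,
so that `m • L ^ n x - t` is an element of `S₂` killed by `L`. Since `φdim D₂ = 0`, `L` is
injective on `S₂`; hence `m • L ^ n x = t ∈ S₁`, and `L ^ n x ∈ S₁` because `K0 ⧸ S₁` is
torsion-free. This is `eta_quotient_le`.

Three facts about modules enter. The subgroup `⟨add M⟩` is finitely generated (`addSpan_fg`), so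
that the infimum defining `eta` is attained (`eta_spec`). The class `[M]` lies in `⟨add M⟩`,
whence injectivity on `⟨D⟩` (`IsZeroIT.eq_zero_of_omegaBar_eq_zero`). Finally `K0 ⧸ ⟨D⟩` is
torsion-free (`mem_classSpan_of_nsmul_mem`). All three rest on Krull-Schmidt decompositions:
existence is an induction on length (`induction_indecomposable`), and uniqueness comes from a
multiplicity function: if `N` has local endomorphism ring, the maps `N → M` that are not split
monomorphisms form an `End(N)`-submodule of `Hom(N, M)`, and the length `mult B N M` of the
quotient is additive in `M`, is `1` on modules isomorphic to `N`, and is nonzero exactly when `N`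
is a summand of `M`. For nonprojective `N` it descends to a homomorphism `K0 → ℤ` (`multHom`), and
these homomorphisms separate the indecomposable generators of `K0`.
-/

namespace IgusaTodorov

/-! ### Endomorphism rings and multiplicities -/

section Multiplicity

theorem length_quotient_eq_add {R : Type*} [Ring R] {V V' V'' : Type*} [AddCommGroup V]
    [Module R V] [AddCommGroup V'] [Module R V'] [AddCommGroup V''] [Module R V'']
    {S : Submodule R V} {S' : Submodule R V'} {S'' : Submodule R V''}
    {p : V →ₗ[R] V'} {q : V →ₗ[R] V''} (hsurj : ∀ v' v'', ∃ v, p v = v' ∧ q v = v'')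
    (hS : ∀ v, v ∈ S ↔ p v ∈ S' ∧ q v ∈ S'') :
    Module.length R (V ⧸ S) = Module.length R (V' ⧸ S') + Module.length R (V'' ⧸ S'') := by
  let F : V →ₗ[R] (V' ⧸ S') × (V'' ⧸ S'') := (S'.mkQ ∘ₗ p).prod (S''.mkQ ∘ₗ q)
  have hF : Function.Surjective F := by
    rintro ⟨x, y⟩
    obtain ⟨v', rfl⟩ := S'.mkQ_surjective x
    obtain ⟨v'', rfl⟩ := S''.mkQ_surjective y
    obtain ⟨v, rfl, rfl⟩ := hsurj v' v''
    exact ⟨v, rfl⟩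
  have hker : LinearMap.ker F = S := by
    ext v
    simp [F, LinearMap.ker_prod, hS]
  rw [← hker, (F.quotKerEquivOfSurjective hF).length_eq, Module.length_prod]

variable {B : Type u} [Ring B] {N : Type u} [AddCommGroup N] [Module B N]
  {M M' M'' : Type u} [AddCommGroup M] [Module B M] [AddCommGroup M'] [Module B M']
  [AddCommGroup M''] [Module B M'']

/-- By Fitting's lemma an endomorphism of an indecomposable module of finite length is either
invertible or nilpotent, so the endomorphism ring is local. -/
theorem isLocalRing_end [IsArtinian B N] [IsNoetherian B N] [Nontrivial N]
    (h : ∀ p q : Submodule B N, IsCompl p q → p = ⊥ ∨ q = ⊥) :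
    IsLocalRing (Module.End B N) where
  isUnit_or_isUnit_of_add_one := by
    intro a b hab
    obtain ⟨n, hn0, hn⟩ := ((Filter.eventually_gt_atTop 0).and
      (LinearMap.eventually_isCompl_ker_pow_range_pow b)).exists
    rcases h _ _ hn with hk | hr
    · right
      have hr : LinearMap.range (b ^ n) = ⊤ := by simpa [hk] using hn.sup_eq_top
      refine (isUnit_pow_iff hn0.ne').1 ((Module.End.isUnit_iff _).2 ⟨?_, ?_⟩)
      · exact LinearMap.ker_eq_bot.1 hk
      · exact LinearMap.range_eq_top.1 hr
    · left
      rw [eq_sub_of_add_eq hab]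
      exact IsNilpotent.isUnit_one_sub ⟨n, LinearMap.range_eq_bot.1 hr⟩

/-- In a (not necessarily commutative) local ring, a summand of a unit is a unit. -/
theorem isUnit_or_isUnit_of_isUnit_add {R : Type*} [Ring R] [IsLocalRing R] {a b : R}
    (h : IsUnit (a + b)) : IsUnit a ∨ IsUnit b := by
  obtain ⟨w, hw⟩ := h
  have h1 : (↑w⁻¹ * a) + (↑w⁻¹ * b) = 1 := by rw [← mul_add, ← hw, Units.inv_mul]
  simpa using IsLocalRing.isUnit_or_isUnit_of_add_one h1

/-- In a module of finite length, if a composite of endomorphisms is invertible, then so is the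
left factor. -/
theorem isUnit_left_of_isUnit_mul [IsNoetherian B N] {a b : Module.End B N}
    (h : IsUnit (a * b)) : IsUnit a := by
  rw [Module.End.isUnit_iff] at h ⊢
  exact IsNoetherian.bijective_of_surjective_endomorphism a (Function.Surjective.of_comp h.2)

variable [IsNoetherian B N] [IsLocalRing (Module.End B N)]

variable (B N M) in
/-- The maps `N → M` that are not split monomorphisms, as a submodule of `Hom(N, M)` over
`End(N)` acting by precomposition (so over the opposite ring). That `f` splits is encoded as
`g ∘ f` being invertible, rather than the identity, for some `g`. -/
def nonSplit : Submodule (Module.End B N)ᵈᵐᵃ (N →ₗ[B] M) where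
  carrier := {f | ∀ g : M →ₗ[B] N, ¬ IsUnit (g ∘ₗ f : Module.End B N)}
  add_mem' := by
    intro f f' hf hf' g h
    rw [LinearMap.comp_add] at h
    exact (isUnit_or_isUnit_of_isUnit_add h).elim (hf g) (hf' g)
  zero_mem' := by
    intro g
    rw [LinearMap.comp_zero]
    exact not_isUnit_zero
  smul_mem' := by
    intro e f hf g h
    exact hf g (isUnit_left_of_isUnit_mul (b := DomMulAct.mk.symm e) h)

theorem mem_nonSplit {f : N →ₗ[B] M} :
    f ∈ nonSplit B N M ↔ ∀ g : M →ₗ[B] N, ¬ IsUnit (g ∘ₗ f : Module.End B N) := Iff.rfl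

variable (B N M) in
/-- The multiplicity of `N`, a module with local endomorphism ring, as a summand of `M`: the length
over `End(N)` of `Hom(N, M)` modulo the maps that are not split monomorphisms. -/
noncomputable def mult : ℕ∞ :=
  Module.length (Module.End B N)ᵈᵐᵃ ((N →ₗ[B] M) ⧸ nonSplit B N M)

theorem mult_eq_add (e : M ≃ₗ[B] M' × M'') : mult B N M = mult B N M' + mult B N M'' := by
  refine length_quotient_eq_add (R := (Module.End B N)ᵈᵐᵃ)
    (p := ⟨⟨fun f => LinearMap.fst B M' M'' ∘ₗ e.toLinearMap ∘ₗ f,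
      fun f f' => by simp only [LinearMap.comp_add]⟩, fun c f => rfl⟩)
    (q := ⟨⟨fun f => LinearMap.snd B M' M'' ∘ₗ e.toLinearMap ∘ₗ f,
      fun f f' => by simp only [LinearMap.comp_add]⟩, fun c f => rfl⟩) ?_ ?_
  · intro f' f''
    refine ⟨e.symm.toLinearMap ∘ₗ f'.prod f'', ?_, ?_⟩
    · ext x
      exact congrArg Prod.fst (e.apply_symm_apply (f' x, f'' x))
    · ext x
      exact congrArg Prod.snd (e.apply_symm_apply (f' x, f'' x))
  · intro f
    constructor
    · exact fun h => ⟨fun g hg => h (g ∘ₗ LinearMap.fst B M' M'' ∘ₗ e.toLinearMap) hg,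
        fun g hg => h (g ∘ₗ LinearMap.snd B M' M'' ∘ₗ e.toLinearMap) hg⟩
    · rintro ⟨h', h''⟩ g hg
      have hsum : (g ∘ₗ f : Module.End B N) =
          (g ∘ₗ e.symm.toLinearMap ∘ₗ LinearMap.inl B M' M'') ∘ₗ
            (LinearMap.fst B M' M'' ∘ₗ e.toLinearMap ∘ₗ f) +
          (g ∘ₗ e.symm.toLinearMap ∘ₗ LinearMap.inr B M' M'') ∘ₗ
            (LinearMap.snd B M' M'' ∘ₗ e.toLinearMap ∘ₗ f) := by
        ext x
        simp [← map_add]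
      rw [hsum] at hg
      exact (isUnit_or_isUnit_of_isUnit_add hg).elim (h' _) (h'' _)

theorem mult_ne_zero_iff :
    mult B N M ≠ 0 ↔ ∃ (f : N →ₗ[B] M) (g : M →ₗ[B] N), g ∘ₗ f = LinearMap.id := by
  rw [mult, Ne, Module.length_eq_zero_iff, Submodule.Quotient.subsingleton_iff,
    Submodule.eq_top_iff']
  simp only [mem_nonSplit, not_forall, not_not]
  constructor
  · rintro ⟨f, g, h⟩
    obtain ⟨w, hw⟩ := h
    refine ⟨f, (↑w⁻¹ : Module.End B N) ∘ₗ g, ?_⟩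
    rw [LinearMap.comp_assoc, ← hw]
    exact w.inv_mul
  · rintro ⟨f, g, h⟩
    exact ⟨f, g, h ▸ isUnit_one⟩

theorem mult_eq_one (e : N ≃ₗ[B] M) : mult B N M = 1 := by
  rw [mult, Module.length_eq_one_iff, isSimpleModule_iff_isCoatom]
  refine ⟨?_, fun p hp => ?_⟩
  · intro h
    have : e.toLinearMap ∈ nonSplit B N M := h ▸ Submodule.mem_top
    refine this e.symm.toLinearMap ?_
    have h1 : (e.symm.toLinearMap ∘ₗ e.toLinearMap : Module.End B N) = 1 := by ext; simp
    exact h1 ▸ isUnit_one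
  · obtain ⟨f, hfp, hf⟩ := SetLike.exists_of_lt hp
    rw [mem_nonSplit] at hf
    push Not at hf
    obtain ⟨g, hg⟩ := hf
    let a : Module.End B N := g ∘ₗ e.toLinearMap
    let b : Module.End B N := e.symm.toLinearMap ∘ₗ f
    have hab : a * b = (g ∘ₗ f : Module.End B N) := by
      ext x
      simp [a, b]
    rw [← hab] at hg
    obtain ⟨w, hw⟩ : IsUnit b :=
      (IsUnit.mul_left_iff (isUnit_left_of_isUnit_mul hg)).1 hg
    -- `f` is invertible, so every map `N → M` factors through it
    refine (Submodule.eq_top_iff').2 fun h => ?_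
    have hf : h = DomMulAct.mk ((↑w⁻¹ : Module.End B N) ∘ₗ e.symm.toLinearMap ∘ₗ h) • f := by
      ext x
      have h1 : b ((↑w⁻¹ : Module.End B N) (e.symm (h x))) = e.symm (h x) := by
        rw [← hw, ← Module.End.mul_apply, w.mul_inv, Module.End.one_apply]
      exact (e.symm.injective h1).symm
    exact hf ▸ p.smul_mem _ hfp

end Multiplicity

/-! ### The function `eta` -/

section Eta

variable {G : Type*} [AddCommGroup G]

/-- For a subgroup, injectivity in the definition of `eta` is a statement about kernels. -/
theorem injOn_image_pow_iff (L : AddMonoid.End G) (X : AddSubgroup G) (n : ℕ) :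
    Set.InjOn L ((fun x => (L ^ n) x) '' (X : Set G)) ↔
      ∀ x ∈ X, (L ^ (n + 1)) x = 0 → (L ^ n) x = 0 := by
  have hpow : ∀ x, (L ^ (n + 1)) x = L ((L ^ n) x) := fun x => by rw [pow_succ']; rfl
  constructor
  · intro h x hx h0
    refine h ⟨x, hx, rfl⟩ ⟨0, X.zero_mem, map_zero (L ^ n)⟩ ?_
    rw [map_zero, ← hpow, h0]
  · rintro h _ ⟨x, hx, rfl⟩ _ ⟨y, hy, rfl⟩ hxy
    have := h (x - y) (X.sub_mem hx hy) (by rw [hpow, map_sub, map_sub, sub_eq_zero]; exact hxy)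
    rwa [map_sub, sub_eq_zero] at this

/-- Fitting's lemma: on a finitely generated subgroup the kernels of the powers of `L` stabilize,
so the set whose infimum is `eta L X` is nonempty and contains its infimum. -/
theorem eta_spec (L : AddMonoid.End G) {X : AddSubgroup G} (hX : X.FG) {n : ℕ} (hn : eta L X ≤ n)
    {x : G} (hx : x ∈ X) (h : (L ^ (n + 1)) x = 0) : (L ^ n) x = 0 := by
  have hfin : Module.Finite ℤ X :=
    Module.Finite.iff_addGroup_fg.2 ((AddGroup.fg_iff_addSubgroup_fg X).2 hX)
  have hker : ∀ (n : ℕ) (x : X), x ∈ LinearMap.ker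
      (((L ^ n : AddMonoid.End G) : G →+ G).comp X.subtype).toIntLinearMap ↔ (L ^ n) x = 0 :=
    fun n x => Iff.rfl
  have hmono : Monotone fun n : ℕ => LinearMap.ker
      (((L ^ n : AddMonoid.End G) : G →+ G).comp X.subtype).toIntLinearMap := by
    refine monotone_nat_of_le_succ fun n x hx => ?_
    rw [hker] at hx ⊢
    rw [pow_succ']
    exact (congrArg L hx).trans (map_zero L)
  obtain ⟨k, hk⟩ := monotone_stabilizes_iff_noetherian.2 (inferInstance : IsNoetherian ℤ X)
    ⟨_, hmono⟩
  have hne : {l : ℕ |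
      ∀ s : ℕ, Set.InjOn L ((fun x => (L ^ (l + s)) x) '' (X : Set G))}.Nonempty := by
    refine ⟨k, fun s => (injOn_image_pow_iff L X _).2 fun x hx h0 => ?_⟩
    have hle := (hk (k + s + 1) (by omega)).symm.trans (hk (k + s) (by omega))
    exact (hker (k + s) ⟨x, hx⟩).1 (hle.le ((hker (k + s + 1) ⟨x, hx⟩).2 h0))
  obtain ⟨s, rfl⟩ := Nat.exists_eq_add_of_le hn
  exact (injOn_image_pow_iff L X _).1 (Nat.sInf_mem hne s) x hx h

theorem eta_le {L : AddMonoid.End G} {X : AddSubgroup G} {l : ℕ}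
    (h : ∀ n, l ≤ n → ∀ x ∈ X, (L ^ (n + 1)) x = 0 → (L ^ n) x = 0) : eta L X ≤ l :=
  Nat.sInf_le fun s => (injOn_image_pow_iff L X _).2 (h _ (Nat.le_add_right l s))

theorem quotient_pow_mk_eq_zero_iff {L : AddMonoid.End G} {S : AddSubgroup G}
    {L' : AddMonoid.End (G ⧸ S)}
    (h : ∀ x, L' (QuotientAddGroup.mk' S x) = QuotientAddGroup.mk' S (L x)) (n : ℕ) (x : G) :
    (L' ^ n) (QuotientAddGroup.mk' S x) = 0 ↔ (L ^ n) x ∈ S := by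
  have hpow : (L' ^ n) (QuotientAddGroup.mk' S x) = QuotientAddGroup.mk' S ((L ^ n) x) := by
    induction n with
    | zero => rfl
    | succ n ih =>
      rw [pow_succ', pow_succ']
      exact (congrArg L' ih).trans (h _)
  rw [hpow]
  exact QuotientAddGroup.eq_zero_iff _

/-- Let `S₁ ≤ S₂` be `L`-invariant subgroups and `L₁`, `L₂` the endomorphisms that `L` induces
modulo them. If `L ^ (n + 1) x ∈ S₁`, then `L ^ n x ∈ S₂` as soon as
`n` is at least the value of `eta` modulo `S₂`. Some multiple `m • L ^ (n + 1) x` is `L t` with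
`t ∈ S₁`, so `m • L ^ n x = t` by injectivity of `L` on `S₂`, and `S₁` is pure. -/
theorem eta_quotient_le {L : AddMonoid.End G} {S₁ S₂ : AddSubgroup G} (hle : S₁ ≤ S₂)
    {L₁ : AddMonoid.End (G ⧸ S₁)} {L₂ : AddMonoid.End (G ⧸ S₂)}
    (h₁ : ∀ x, L₁ (QuotientAddGroup.mk' S₁ x) = QuotientAddGroup.mk' S₁ (L x))
    (h₂ : ∀ x, L₂ (QuotientAddGroup.mk' S₂ x) = QuotientAddGroup.mk' S₂ (L x))
    (hinj : ∀ x ∈ S₂, L x = 0 → x = 0)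
    (hpre : ∀ s ∈ S₁, ∃ t ∈ S₁, ∃ m : ℕ, 0 < m ∧ L t = m • s)
    (hpure : ∀ (m : ℕ) (x : G), 0 < m → m • x ∈ S₁ → x ∈ S₁) {X : AddSubgroup G} (hX : X.FG) :
    eta L₁ (X.map (QuotientAddGroup.mk' S₁)) ≤ eta L₂ (X.map (QuotientAddGroup.mk' S₂)) := by
  have hX₂ : (X.map (QuotientAddGroup.mk' S₂)).FG := by
    obtain ⟨T, hT, hfin⟩ := (AddSubgroup.fg_iff X).1 hX
    exact (AddSubgroup.fg_iff _).2
      ⟨_, by rw [← hT, AddMonoidHom.map_closure], hfin.image (QuotientAddGroup.mk' S₂)⟩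
  refine eta_le ?_
  rintro n hn _ ⟨x, hx, rfl⟩ h
  rw [quotient_pow_mk_eq_zero_iff h₁] at h ⊢
  have hmem : (L ^ n) x ∈ S₂ := by
    rw [← quotient_pow_mk_eq_zero_iff h₂]
    exact eta_spec _ hX₂ hn ⟨x, hx, rfl⟩
      ((quotient_pow_mk_eq_zero_iff h₂ _ _).2 (hle h))
  obtain ⟨t, ht, m, hm, hmt⟩ := hpre _ h
  have h0 : m • (L ^ n) x - t = 0 := by
    refine hinj _ (S₂.sub_mem (S₂.nsmul_mem hmem m) (hle ht)) ?_
    rw [map_sub, map_nsmul, hmt, pow_succ', sub_eq_zero]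
    rfl
  exact hpure m _ hm (sub_eq_zero.1 h0 ▸ ht)

end Eta

/-! ### Summands and decompositions -/

section Decomposition

variable {B : Type u} [Ring B]

theorem isSummand_of_comp_eq_id [IsArtinianRing B] {N M : FGModuleCat.{u} B} {f : N →ₗ[B] M}
    {g : M →ₗ[B] N} (h : g ∘ₗ f = LinearMap.id) : IsSummand N M := by
  have hgf : ∀ x, g (f x) = x := fun x => LinearMap.congr_fun h x
  refine ⟨FGModuleCat.of B (LinearMap.ker g), ⟨show M ≃ₗ[B] N × LinearMap.ker g from
    { toFun := fun m => (g m, ⟨m - f (g m), by simp [hgf]⟩)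
      invFun := fun y => f y.1 + y.2
      map_add' := fun x y => by
        ext
        · simp
        · simp only [map_add, Prod.snd_add, Submodule.coe_add]; abel
      map_smul' := fun c x => by
        ext
        · simp
        · simp [smul_sub]
      left_inv := fun m => by simp
      right_inv := fun y => by
        have := LinearMap.mem_ker.1 y.2.2
        ext
        · simp [hgf, this]
        · simp [hgf, this] }⟩⟩

theorem IsSummand.exists_comp_eq_id {N M : FGModuleCat.{u} B} (h : IsSummand N M) :
    ∃ (f : N →ₗ[B] M) (g : M →ₗ[B] N), g ∘ₗ f = LinearMap.id := by
  obtain ⟨N', ⟨e⟩⟩ := h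
  refine ⟨e.symm.toLinearMap ∘ₗ LinearMap.inl B N N', LinearMap.fst B N N' ∘ₗ e.toLinearMap, ?_⟩
  ext x
  simp

theorem IsSummand.refl (M : FGModuleCat.{u} B) : IsSummand M M :=
  ⟨FGModuleCat.of B PUnit, ⟨LinearEquiv.prodUnique.symm⟩⟩

theorem isSummand_fst {M M' M'' : FGModuleCat.{u} B} (e : M ≃ₗ[B] M' × M'') : IsSummand M' M :=
  ⟨M'', ⟨e⟩⟩

theorem isSummand_snd {M M' M'' : FGModuleCat.{u} B} (e : M ≃ₗ[B] M' × M'') : IsSummand M'' M :=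
  ⟨M', ⟨e.trans (LinearEquiv.prodComm B M' M'')⟩⟩

theorem IsSummand.trans [IsArtinianRing B] {N M K : FGModuleCat.{u} B} (h : IsSummand N M)
    (h' : IsSummand M K) : IsSummand N K := by
  obtain ⟨f, g, hfg⟩ := h.exists_comp_eq_id
  obtain ⟨f', g', hfg'⟩ := h'.exists_comp_eq_id
  refine isSummand_of_comp_eq_id (f := f' ∘ₗ f) (g := g ∘ₗ g') ?_
  rw [LinearMap.comp_assoc, ← LinearMap.comp_assoc f, hfg', LinearMap.id_comp, hfg]

/-- A nonzero summand of an indecomposable module is the whole module. -/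
theorem IsIndecomposable.nonempty_equiv_of_isSummand {N M : FGModuleCat.{u} B}
    (hM : IsIndecomposable M) [Nontrivial N] (h : IsSummand N M) : Nonempty (N ≃ₗ[B] M) := by
  obtain ⟨f, g, hfg⟩ := h.exists_comp_eq_id
  have hgf : ∀ x, g (f x) = x := fun x => LinearMap.congr_fun hfg x
  have hidem : IsIdempotentElem (f ∘ₗ g : Module.End B M) := by
    ext x
    simp [hgf]
  rcases hM.2 _ _ (LinearMap.IsIdempotentElem.isCompl hidem) with hr | hk
  · exfalso
    obtain ⟨x, hx⟩ := exists_ne (0 : N)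
    apply hx
    have := LinearMap.congr_fun (LinearMap.range_eq_bot.1 hr) (f x)
    rw [LinearMap.comp_apply, hgf, LinearMap.zero_apply] at this
    rw [← hgf x, this, map_zero]
  · refine ⟨(LinearEquiv.ofBijective g ⟨?_, fun x => ⟨f x, hgf x⟩⟩).symm⟩
    refine Function.Injective.of_comp (f := f) ?_
    exact LinearMap.ker_eq_bot.1 hk

/-- Every finitely generated module over an artinian ring is a finite direct sum of
indecomposables; in the form of an induction principle. -/
theorem induction_indecomposable [IsArtinianRing B] {P : FGModuleCat.{u} B → Prop}
    (zero : ∀ M : FGModuleCat.{u} B, Subsingleton M → P M)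
    (indecomposable : ∀ M, IsIndecomposable M → P M)
    (prod : ∀ M M' M'' : FGModuleCat.{u} B, (M ≃ₗ[B] M' × M'') → P M' → P M'' → P M)
    (M : FGModuleCat.{u} B) : P M := by
  induction hl : Module.length B M using WellFoundedLT.induction generalizing M with
  | ind l ih =>
    subst hl
    rcases subsingleton_or_nontrivial M with hM | hM
    · exact zero M hM
    by_cases hI : IsIndecomposable M
    · exact indecomposable M hI
    · simp only [IsIndecomposable, not_and, not_forall, not_or] at hI
      obtain ⟨p, q, hpq, hp, hq⟩ := hI hM
      have hp' : p ≠ ⊤ := fun h => hq (by simpa [h] using hpq.inf_eq_bot)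
      have hq' : q ≠ ⊤ := fun h => hp (by simpa [h] using hpq.inf_eq_bot)
      exact prod M (FGModuleCat.of B p) (FGModuleCat.of B q)
        (Submodule.prodEquivOfIsCompl p q hpq).symm
        (ih _ (Submodule.length_lt hp') _ rfl) (ih _ (Submodule.length_lt hq') _ rfl)

theorem IsIndecomposable.isLocalRing_end [IsArtinianRing B] {N : FGModuleCat.{u} B}
    (hN : IsIndecomposable N) : IsLocalRing (Module.End B N) :=
  have := hN.1
  IgusaTodorov.isLocalRing_end hN.2

end Decomposition

/-! ### The structure of `K0` and the purity of `⟨D⟩` -/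

section K0

variable {B : Type u} [Ring B]

theorem K0.cls_of_subsingleton (M : FGModuleCat.{u} B) (_ : Subsingleton M) : K0.cls M = 0 :=
  K0.cls_projective M inferInstance

theorem K0.cls_eq_of_equiv {M M' : FGModuleCat.{u} B} (e : M ≃ₗ[B] M') :
    K0.cls M = K0.cls M' := by
  rw [K0.cls_of_equiv_prod (M'' := FGModuleCat.of B PUnit) (e.trans LinearEquiv.prodUnique.symm),
    K0.cls_of_subsingleton (FGModuleCat.of B PUnit) (inferInstanceAs (Subsingleton PUnit)),
    add_zero]

theorem nontrivial_of_isLocalRing_end {N : Type u} [AddCommGroup N] [Module B N]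
    [IsLocalRing (Module.End B N)] : Nontrivial N := by
  by_contra h
  rw [not_nontrivial_iff_subsingleton] at h
  exact one_ne_zero (α := Module.End B N) (LinearMap.ext fun x => Subsingleton.elim _ _)

variable {D : CategoryTheory.ObjectProperty (FGModuleCat.{u} B)}

theorem of_isSummand_of_eq_addClosure (hD : D = addClosure D) {N M : FGModuleCat.{u} B}
    (hM : D M) (h : IsSummand N M) : D N := by
  rw [hD]
  obtain ⟨N', ⟨e⟩⟩ := h
  exact ⟨1, fun _ => M, fun _ => hM, N', ⟨(LinearEquiv.funUnique (Fin 1) B M).trans e⟩⟩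

theorem prod_of_eq_addClosure (hD : D = addClosure D) {M M' : FGModuleCat.{u} B}
    (hM : D M) (hM' : D M') : D (FGModuleCat.of B (M × M')) := by
  rw [hD]
  refine ⟨2, ![M, M'], fun i => by fin_cases i <;> assumption, FGModuleCat.of B PUnit,
    ⟨(LinearEquiv.piFinTwo B fun i => (![M, M'] i : FGModuleCat.{u} B)).trans
      (show (M × M') ≃ₗ[B] (M × M') × PUnit.{u + 1} from LinearEquiv.prodUnique.symm)⟩⟩

variable [IsArtinianRing B]

theorem addSpan_mono {N M : FGModuleCat.{u} B} (h : IsSummand N M) : addSpan N ≤ addSpan M :=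
  AddSubgroup.closure_mono fun _ ⟨K, hK, hKN, hx⟩ => ⟨K, hK, hKN.trans h, hx⟩

/-- A module is the direct sum of indecomposable summands of itself. -/
theorem cls_mem_addSpan (M : FGModuleCat.{u} B) : K0.cls M ∈ addSpan M := by
  induction M using induction_indecomposable with
  | zero M hM => exact K0.cls_of_subsingleton M hM ▸ zero_mem _
  | indecomposable M hM => exact AddSubgroup.subset_closure ⟨M, hM, IsSummand.refl M, rfl⟩
  | prod M M' M'' e h' h'' =>
    rw [K0.cls_of_equiv_prod e]
    exact add_mem (addSpan_mono (isSummand_fst e) h') (addSpan_mono (isSummand_snd e) h'')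

theorem isSummand_of_mult_ne_zero {N M : FGModuleCat.{u} B} [IsLocalRing (Module.End B N)]
    (h : mult B N M ≠ 0) : IsSummand N M := by
  obtain ⟨f, g, hfg⟩ := mult_ne_zero_iff.1 h
  exact isSummand_of_comp_eq_id hfg

theorem IsSummand.mult_ne_zero {N M : FGModuleCat.{u} B} [IsLocalRing (Module.End B N)]
    (h : IsSummand N M) : mult B N M ≠ 0 :=
  mult_ne_zero_iff.2 h.exists_comp_eq_id

/-- Multiplicities are finite: an indecomposable module has multiplicity `0` or `1`. -/
theorem mult_ne_top {N : FGModuleCat.{u} B} [IsLocalRing (Module.End B N)]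
    (M : FGModuleCat.{u} B) : mult B N M ≠ ⊤ := by
  have := nontrivial_of_isLocalRing_end (B := B) (N := N)
  induction M using induction_indecomposable with
  | zero M hM =>
    by_contra h
    obtain ⟨f, g, hfg⟩ := mult_ne_zero_iff.1 (h ▸ ENat.top_ne_zero)
    obtain ⟨x, hx⟩ := exists_ne (0 : N)
    refine hx ?_
    rw [← LinearMap.id_apply (R := B) x, ← hfg, LinearMap.comp_apply, Subsingleton.elim (f x) 0,
      map_zero]
  | indecomposable M hM =>
    by_cases h : mult B N M = 0
    · simp [h]
    · obtain ⟨e⟩ := hM.nonempty_equiv_of_isSummand (isSummand_of_mult_ne_zero h)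
      simp [mult_eq_one e]
  | prod M M' M'' e h' h'' => simp [mult_eq_add e, h', h'']

/-- An indecomposable summand of a direct sum is a summand of one of the terms. -/
theorem IsSummand.fst_or_snd {N M M' M'' : FGModuleCat.{u} B} (hN : IsIndecomposable N)
    (h : IsSummand N M) (e : M ≃ₗ[B] M' × M'') : IsSummand N M' ∨ IsSummand N M'' := by
  have := hN.isLocalRing_end
  by_contra! hne
  refine h.mult_ne_zero ?_
  rw [mult_eq_add e, not_not.1 (mt isSummand_of_mult_ne_zero hne.1),
    not_not.1 (mt isSummand_of_mult_ne_zero hne.2), add_zero]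

/-- Up to isomorphism a module has only finitely many indecomposable summands. -/
theorem addSpan_fg (M : FGModuleCat.{u} B) : (addSpan M).FG := by
  refine (AddSubgroup.fg_iff _).2 ⟨_, rfl, ?_⟩
  induction M using induction_indecomposable with
  | zero M hM =>
    refine Set.Finite.subset Set.finite_empty ?_
    rintro _ ⟨N, hN, hNM, rfl⟩
    obtain ⟨⟨N', ⟨e⟩⟩, hN⟩ := hNM, hN.1
    have : Subsingleton (N × N') := e.symm.toEquiv.subsingleton
    exact not_subsingleton N (Prod.fst_surjective (β := N')).subsingleton
  | indecomposable M hM =>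
    refine Set.Finite.subset (Set.finite_singleton (K0.cls M)) ?_
    rintro _ ⟨N, hN, hNM, rfl⟩
    have := hN.1
    obtain ⟨e⟩ := hM.nonempty_equiv_of_isSummand hNM
    exact K0.cls_eq_of_equiv e
  | prod M M' M'' e h' h'' =>
    refine Set.Finite.subset (h'.union h'') ?_
    rintro _ ⟨N, hN, hNM, rfl⟩
    exact (hNM.fst_or_snd hN e).imp (fun h => ⟨N, hN, h, rfl⟩) (fun h => ⟨N, hN, h, rfl⟩)

/-- The homomorphism `K0 B → ℤ` that sends `[M]` to the multiplicity of `N` in `M`, where `N` is a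
nonprojective module with local endomorphism ring. -/
noncomputable def multHom (N : FGModuleCat.{u} B) [IsLocalRing (Module.End B N)]
    (hN : ¬ Module.Projective B N) : K0 B →+ ℤ :=
  QuotientAddGroup.lift _ (FreeAbelianGroup.lift fun M => ((mult B N M).toNat : ℤ)) (by
    rw [AddSubgroup.closure_le]
    rintro _ (⟨M, M', M'', ⟨e⟩, rfl⟩ | ⟨P, hP, rfl⟩)
    · simp [mult_eq_add e, ENat.toNat_add (mult_ne_top M') (mult_ne_top M'')]
    · have : mult B N P = 0 := by
        by_contra h
        obtain ⟨f, g, hfg⟩ := mult_ne_zero_iff.1 h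
        exact hN (Module.Projective.of_split f g hfg)
      simp [this])

theorem multHom_cls (N : FGModuleCat.{u} B) [IsLocalRing (Module.End B N)]
    (hN : ¬ Module.Projective B N) (M : FGModuleCat.{u} B) :
    multHom N hN (K0.cls M) = (mult B N M).toNat :=
  FreeAbelianGroup.lift_apply_of (fun M : FGModuleCat.{u} B => ((mult B N M).toNat : ℤ)) M

/-- The classes of pairwise nonisomorphic representatives of the indecomposable modules generate
`K0 B`. -/
theorem exists_representatives : ∃ (ι : Type (u + 1)) (X : ι → FGModuleCat.{u} B),
    (∀ i, IsIndecomposable (X i)) ∧ (∀ i j, Nonempty (X i ≃ₗ[B] X j) → i = j) ∧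
    ∀ x : K0 B, ∃ a : ι →₀ ℤ, x = a.sum fun i n => n • K0.cls (X i) := by
  let s : Setoid {N : FGModuleCat.{u} B // IsIndecomposable N} :=
    { r := fun N N' => Nonempty (N.1 ≃ₗ[B] N'.1)
      iseqv := ⟨fun _ => ⟨LinearEquiv.refl B _⟩, fun ⟨e⟩ => ⟨e.symm⟩,
        fun ⟨e⟩ ⟨e'⟩ => ⟨e.trans e'⟩⟩ }
  let X : Quotient s → FGModuleCat.{u} B := fun i => i.out.1
  have hX : ∀ N, IsIndecomposable N → ∃ i, K0.cls (X i) = K0.cls N := by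
    intro N hN
    obtain ⟨e⟩ : Nonempty (X ⟦⟨N, hN⟩⟧ ≃ₗ[B] N) := Quotient.mk_out (s := s) ⟨N, hN⟩
    exact ⟨_, K0.cls_eq_of_equiv e⟩
  refine ⟨Quotient s, X, fun i => i.out.2, fun i j h => Quotient.out_equiv_out.1 h, fun x => ?_⟩
  have hcls : ∀ M, K0.cls M ∈ AddSubgroup.closure (Set.range fun i => K0.cls (X i)) := by
    intro M
    refine (AddSubgroup.closure_le _).2 ?_ (cls_mem_addSpan M)
    rintro _ ⟨N, hN, -, rfl⟩
    obtain ⟨i, hi⟩ := hX N hN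
    exact AddSubgroup.subset_closure ⟨i, hi⟩
  have hx : x ∈ AddSubgroup.closure (Set.range fun i => K0.cls (X i)) := by
    obtain ⟨y, rfl⟩ := QuotientAddGroup.mk_surjective x
    induction y using FreeAbelianGroup.induction_on with
    | zero => exact zero_mem _
    | of M => exact hcls M
    | neg M _ => exact neg_mem (hcls M)
    | add y z hy hz => exact add_mem hy hz
  obtain ⟨a, ha⟩ := AddSubgroup.mem_closure_range_iff.1 hx
  exact ⟨a, ha⟩

theorem exists_mem_addSpan_of_mem_classSpan (hD : D = addClosure D) {x : K0 B}
    (hx : x ∈ classSpan D) : ∃ M, D M ∧ x ∈ addSpan M := by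
  induction hx using AddSubgroup.closure_induction with
  | mem x hx =>
    obtain ⟨N, hN, rfl⟩ := hx
    exact ⟨N, hN, cls_mem_addSpan N⟩
  | zero =>
    refine ⟨FGModuleCat.of B PUnit, ?_, zero_mem _⟩
    rw [hD]
    exact ⟨0, Fin.elim0, fun i => i.elim0, FGModuleCat.of B PUnit, ⟨0, 0,
      fun _ => Subsingleton.elim _ _, fun _ => Subsingleton.elim _ _⟩⟩
  | add x y _ _ hx hy =>
    obtain ⟨M, hM, hxM⟩ := hx
    obtain ⟨M', hM', hyM'⟩ := hy
    exact ⟨_, prod_of_eq_addClosure hD hM hM',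
      add_mem (addSpan_mono (isSummand_fst (LinearEquiv.refl B _)) hxM)
        (addSpan_mono (isSummand_snd (LinearEquiv.refl B _)) hyM')⟩
  | neg x _ hx =>
    obtain ⟨M, hM, hxM⟩ := hx
    exact ⟨M, hM, neg_mem hxM⟩

/-- The quotient `K0 B ⧸ ⟨D⟩` is torsion-free: the multiplicity in `x` of an indecomposable module
outside `D` vanishes if it vanishes in a positive multiple of `x`. -/
theorem mem_classSpan_of_nsmul_mem (hD : D = addClosure D) {m : ℕ} {x : K0 B} (hm : 0 < m)
    (hx : m • x ∈ classSpan D) : x ∈ classSpan D := by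
  obtain ⟨ι, X, hX, hinj, hgen⟩ := exists_representatives (B := B)
  obtain ⟨a, rfl⟩ := hgen x
  refine sum_mem fun i _ => ?_
  by_cases hP : Module.Projective B (X i)
  · simp only [K0.cls_projective _ hP, smul_zero, zero_mem]
  by_cases hDi : D (X i)
  · have hmem : K0.cls (X i) ∈ classSpan D := AddSubgroup.subset_closure ⟨_, hDi, rfl⟩
    exact zsmul_mem hmem _
  have := (hX i).isLocalRing_end
  have hker : classSpan D ≤ (multHom (X i) hP).ker := by
    refine (AddSubgroup.closure_le _).2 ?_
    rintro _ ⟨N, hN, rfl⟩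
    have h0 : mult B (X i) N = 0 := by
      by_contra h
      exact hDi (of_isSummand_of_eq_addClosure hD hN (isSummand_of_mult_ne_zero h))
    simp [AddMonoidHom.mem_ker, multHom_cls, h0]
  have hterm : ∀ j, j ≠ i → (mult B (X i) (X j)) = 0 := by
    intro j hj
    by_contra h
    have := (hX i).1
    obtain ⟨e⟩ := (hX j).nonempty_equiv_of_isSummand (isSummand_of_mult_ne_zero h)
    exact hj (hinj _ _ ⟨e.symm⟩)
  have hval : multHom (X i) hP (a.sum fun j n => n • K0.cls (X j)) = a i := by
    rw [map_finsuppSum, Finsupp.sum_eq_single i]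
    · simp [multHom_cls, mult_eq_one (LinearEquiv.refl B (X i))]
    · intro j _ hj
      simp [multHom_cls, hterm j hj]
    · simp
  have h0 := hker hx
  rw [AddMonoidHom.mem_ker, map_nsmul, hval, smul_eq_zero] at h0
  simp only [h0.resolve_left hm.ne', zero_smul, zero_mem]

/-! ### `0`-Igusa-Todorov subcategories -/

/-- The syzygy is injective on all of `⟨D⟩`, because `⟨D⟩` is the union of the subgroups `⟨add M⟩`
with `M` in `D`. -/
theorem IsZeroIT.eq_zero_of_omegaBar_eq_zero (hD : IsZeroIT D) {x : K0 B} (hx : x ∈ classSpan D)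
    (h : omegaBar B x = 0) : x = 0 := by
  obtain ⟨M, hM, hxM⟩ := exists_mem_addSpan_of_mem_classSpan hD.eq_addClosure hx
  have hphi : phi M = 0 := by
    have hle : (phi M : ℕ∞) ≤ phiDim D :=
      le_iSup₂ (f := fun (M : FGModuleCat.{u} B) (_ : D M) => (phi M : ℕ∞)) M hM
    rw [hD.phiDim_eq_zero] at hle
    exact Nat.le_zero.1 (by exact_mod_cast hle)
  exact eta_spec (n := 0) (omegaBar B) (addSpan_fg M) hphi.le hxM (by simpa using h)

theorem IsZeroITWithPreimages.exists_omegaBar_eq_nsmul (hD : IsZeroITWithPreimages D) {s : K0 B}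
    (hs : s ∈ classSpan D) : ∃ t ∈ classSpan D, ∃ m : ℕ, 0 < m ∧ omegaBar B t = m • s := by
  induction hs using AddSubgroup.closure_induction with
  | mem x hx =>
    obtain ⟨N, hN, rfl⟩ := hx
    obtain ⟨N₁, N₂, h₁, h₂, h⟩ := hD.exists_preimage N hN
    exact ⟨_, sub_mem (AddSubgroup.subset_closure ⟨N₁, h₁, rfl⟩)
      (AddSubgroup.subset_closure ⟨N₂, h₂, rfl⟩), h⟩
  | zero => exact ⟨0, zero_mem _, 1, one_pos, by simp⟩
  | add x y _ _ hx hy =>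
    obtain ⟨t, ht, m, hm, h⟩ := hx
    obtain ⟨t', ht', m', hm', h'⟩ := hy
    refine ⟨m' • t + m • t', add_mem (nsmul_mem ht _) (nsmul_mem ht' _), m * m',
      Nat.mul_pos hm hm', ?_⟩
    rw [map_add, map_nsmul, map_nsmul, h, h', smul_smul, smul_smul, smul_add, mul_comm m' m]
  | neg x _ hx =>
    obtain ⟨t, ht, m, hm, h⟩ := hx
    exact ⟨-t, neg_mem ht, m, hm, by rw [map_neg, h, smul_neg]⟩

end K0

end IgusaTodorov

theorem mainTheorem3 (A : Type u) [Ring A] [IsArtinAlgebra A]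
    (D₁ D₂ : CategoryTheory.ObjectProperty (FGModuleCat.{u} Aᵐᵒᵖ)) (hle : D₁ ≤ D₂)
    (h₁ : IgusaTodorov.IsZeroITWithPreimages D₁) (h₂ : IgusaTodorov.IsZeroIT D₂)
    (M : FGModuleCat.{u} Aᵐᵒᵖ) :
    IgusaTodorov.Phi D₁ h₁.syzygyInvariant M ≤ IgusaTodorov.Phi D₂ h₂.syzygyInvariant M := by
  refine IgusaTodorov.eta_quotient_le (L := IgusaTodorov.omegaBar Aᵐᵒᵖ) ?_ (fun _ => rfl)
    (fun _ => rfl) (fun _ => h₂.eq_zero_of_omegaBar_eq_zero)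
    (fun _ => h₁.exists_omegaBar_eq_nsmul)
    (fun _ _ => IgusaTodorov.mem_classSpan_of_nsmul_mem h₁.eq_addClosure)
    (IgusaTodorov.addSpan_fg M)
  exact AddSubgroup.closure_mono fun _ ⟨N, hN, hx⟩ => ⟨N, hle N hN, hx⟩
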